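/- There exist absolute constants $C, D > 0$ such that the following holds. Let $u,\ell,m$ be nonnegative integers, let $n = 2^\ell$, let $S \subseteq \mathbb{F}_2^u$ be a set of size $m$, and let $\lambda = m/n$. Let $h : \mathbb{F}_2^u \to \mathbb{F}_2^\ell$ be a linear map chosen uniformly at random among all linear maps $\mathbb{F}_2^u \to \mathbb{F}_2^\ell$, and let $$\mathsf M(S,h) = \max_{y \in \mathbb{F}_2^\ell} |h^{-1}(y) \cap S|$$ be the maximum load. Then, for every real $T > 0$ satisfying $T \ge D \lambda n^{1/T}$, $$\Pr_h[\mathsf M(S,h) \ge T] \le C \left( \frac{\lambda n^{1/T}}{T} \right)^2 .$$ -/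

import Mathlib

noncomputable section

/-- The vector space `𝔽₂^d`. -/
abbrev F2Vec (d : ℕ) : Type := Fin d → ZMod 2

/-- The linear maps `𝔽₂^u → 𝔽₂^ℓ`. -/
abbrev F2LinMap (u l : ℕ) : Type := F2Vec u →ₗ[ZMod 2] F2Vec l

instance instFintypeF2LinMap (u l : ℕ) : Fintype (F2LinMap u l) :=
  haveI : Finite (F2LinMap u l) := Finite.of_injective _ DFunLike.coe_injective
  Fintype.ofFinite _

/-- The law of a uniformly random linear map `𝔽₂^u → 𝔽₂^ℓ`. -/
def uniformLinMap (u l : ℕ) : PMF (F2LinMap u l) :=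
  PMF.uniformOfFintype (F2LinMap u l)

/-- `Pr_h[h ∈ E]` for a uniformly random linear map `h : 𝔽₂^u → 𝔽₂^ℓ`. -/
def prLinMap (u l : ℕ) (E : Set (F2LinMap u l)) : ℝ :=
  ((uniformLinMap u l).toOuterMeasure E).toReal

/-- The load `|h⁻¹(y) ∩ S|` of the bin `y`. -/
def load {u l : ℕ} (S : Finset (F2Vec u)) (h : F2LinMap u l) (y : F2Vec l) : ℕ :=
  (S.filter fun x => h x = y).card

/-- The maximum load `max_y |h⁻¹(y) ∩ S|`, over all bins `y ∈ 𝔽₂^ℓ`. -/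
def maxLoad {u l : ℕ} (S : Finset (F2Vec u)) (h : F2LinMap u l) : ℕ :=
  Finset.univ.sup' Finset.univ_nonempty fun y : F2Vec l => load S h y

/-- The probability is the proportion of linear maps lying in the event. -/
theorem prLinMap_eq (u l : ℕ) (E : Set (F2LinMap u l)) :
    prLinMap u l E = (Nat.card E : ℝ) / (Nat.card (F2LinMap u l) : ℝ) := by
  classical
  unfold prLinMap uniformLinMap
  rw [PMF.toOuterMeasure_uniformOfFintype_apply, ENNReal.toReal_div, Nat.card_eq_fintype_card,
    Nat.card_eq_fintype_card]
  simp

end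

noncomputable section

open Finset BigOperators

/-! Exponential moment plus dimension reduction. With weight `b = e * n ^ (1 / T)` on `S × {0}` and
`1` elsewhere, `fiberMean` is the average of `b ^ load` over the bins, so a load of at least `T`
forces it above `b ^ T / n = e ^ T`. `expect_fiberMean_tail_le` bounds this tail by induction on
`dim V`. Let `ε` be the mean weight minus `1`. Split off a vector `x ≠ 0` and condition on its image
`c`: merging points along `(x, c)` halves `V` and turns `ε` into `2 * ε + N c`. A good choice of `x`
makes the mean of `N` at most `ε ^ 2`, and the quadratic bound then reproduces itself. -/

/-- The average over all bins `s` of the product of the weights of the elements that the map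
`(v, t) ↦ t - h v` sends to `s`. -/
def fiberMean {V U : Type} [AddCommGroup V] [AddCommGroup U] [Module (ZMod 2) V]
    [Module (ZMod 2) U] [Fintype V] [Fintype U] (w : V → U → ℝ) (h : V →ₗ[ZMod 2] U) : ℝ :=
  𝔼 s, ∏ v, w v (s + h v)

/-- The function `t ↦ min 1 (t ^ 2)` grows with slope at most `2` on `t ≥ 0`. A bound linear in `x -
a` is needed because only the mean of `N` is controlled, not its second moment. -/
theorem min_one_sq_le {k a x : ℝ} (hk : 0 ≤ k) (ha : 0 ≤ a) (hx : a ≤ x) :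
    min 1 ((k * x) ^ 2) ≤ (k * a) ^ 2 + 2 * k * (x - a) := by
  have h₀ : 0 ≤ k * a := mul_nonneg hk ha
  have h₁ : k * a ≤ k * x := mul_le_mul_of_nonneg_left hx hk
  rcases le_total (k * x) 1 with h | h
  · exact (min_le_right _ _).trans (by nlinarith)
  · exact (min_le_left _ _).trans (by nlinarith [sq_nonneg (k * a - 1)])

/-- Closes the induction, where the threshold base passes from `y` to `y ^ 2`; the slack is exactly
`8 / ((y - 1) * (y + 1) ^ 2)`. -/
theorem two_div_sq_recursion {y : ℝ} (hy : 1 < y) :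
    4 * (2 / (y ^ 2 - 1)) ^ 2 + 2 * (2 / (y ^ 2 - 1)) ≤ (2 / (y - 1)) ^ 2 := by
  have h₁ : 0 < y - 1 := by linarith
  have h₂ : 0 < y + 1 := by linarith
  have h₃ : y ^ 2 - 1 = (y - 1) * (y + 1) := by ring
  have h : (2 / (y - 1)) ^ 2 - (4 * (2 / (y ^ 2 - 1)) ^ 2 + 2 * (2 / (y ^ 2 - 1))) =
      8 / ((y - 1) * (y + 1) ^ 2) := by
    rw [h₃]
    field_simp
    ring
  have : 0 ≤ 8 / ((y - 1) * (y + 1) ^ 2) := by positivity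
  linarith

theorem sq_expect_le_expect_sq {α : Type*} [Fintype α] [Nonempty α] (a : α → ℝ) :
    (𝔼 v, a v) ^ 2 ≤ 𝔼 v, a v * a v := by
  have h := sq_sum_le_card_mul_sum_sq (s := (univ : Finset α)) (f := a)
  rw [card_univ] at h
  have hc : (0 : ℝ) < Fintype.card α := by exact_mod_cast Fintype.card_pos
  rw [Fintype.expect_eq_sum_div_card, Fintype.expect_eq_sum_div_card, div_pow,
    div_le_div_iff₀ (by positivity) hc]
  simp only [← pow_two]
  nlinarith

/-- Some nonzero shift has autocorrelation at most the square of the mean. -/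
theorem exists_ne_zero_expect_mul_shift_le {V : Type*} [AddCommGroup V] [Fintype V] [Nontrivial V]
    (a : V → ℝ) : ∃ x : V, x ≠ 0 ∧ 𝔼 v, a v * a (v + x) ≤ (𝔼 v, a v) ^ 2 := by
  classical
  by_contra! hcon
  -- Over all shifts the autocorrelation averages to the squared mean, and the zero shift is at
  -- least that, so the other shifts cannot all exceed it.
  have hsum : 𝔼 x, 𝔼 v, a v * a (v + x) = (𝔼 v, a v) ^ 2 := by
    rw [expect_comm]
    have : ∀ v, 𝔼 x, a v * a (v + x) = a v * 𝔼 x, a x := fun v => by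
      rw [← mul_expect]
      congr 1
      exact Fintype.expect_equiv (Equiv.addLeft v) _ _ fun _ => rfl
    simp only [this]
    rw [← expect_mul, pow_two]
  obtain ⟨x₀, hx₀⟩ := exists_ne (0 : V)
  have hlt : ∑ _x : V, (𝔼 v, a v) ^ 2 < ∑ x, 𝔼 v, a v * a (v + x) := by
    refine sum_lt_sum (fun x _ => ?_) ⟨x₀, mem_univ _, hcon x₀ hx₀⟩
    rcases eq_or_ne x 0 with rfl | hx
    · simpa using sq_expect_le_expect_sq a
    · exact (hcon x hx).le
  rw [← Fintype.card_mul_expect, ← Fintype.card_mul_expect, hsum, Fintype.expect_const] at hlt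
  exact lt_irrefl _ hlt

/-- A nonzero vector splits off as a coordinate. -/
theorem exists_linearEquiv_prod {V : Type} [AddCommGroup V] [Module (ZMod 2) V] {x : V}
    (hx : x ≠ 0) :
    ∃ (W : Submodule (ZMod 2) V) (e : (ZMod 2 × W) ≃ₗ[ZMod 2] V), e (1, 0) = x := by
  obtain ⟨W, hW⟩ := Submodule.exists_isCompl (Submodule.span (ZMod 2) {x})
  refine ⟨W, ((LinearEquiv.toSpanNonzeroSingleton (ZMod 2) V x hx).prodCongr
    (LinearEquiv.refl _ _)).trans (Submodule.prodEquivOfIsCompl _ _ hW), ?_⟩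
  simp

/-! ### Merging along a split-off coordinate -/

section Split

variable {V W U : Type} [AddCommGroup V] [AddCommGroup W] [AddCommGroup U] [Module (ZMod 2) V]
  [Module (ZMod 2) W] [Fintype V] [Fintype W] [Fintype U]

/-- The weights obtained from `w` by identifying points that differ by `(e (1, 0), c)`. -/
def mergeWeight (e : (ZMod 2 × W) ≃ₗ[ZMod 2] V) (w : V → U → ℝ) (c : U) (y : W) (s : U) : ℝ :=
  w (e (0, y)) s * w (e (1, y)) (s + c)

theorem expect_split (e : (ZMod 2 × W) ≃ₗ[ZMod 2] V) (f : V → ℝ) :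
    2 * 𝔼 v, f v = 𝔼 y, f (e (0, y)) + 𝔼 y, f (e (1, y)) := by
  rw [← Fintype.expect_equiv e.toEquiv (fun p => f (e p)) f fun _ => rfl, ← univ_product_univ,
    expect_product, Fintype.expect_eq_sum_div_card]
  have : (univ : Finset (ZMod 2)) = {0, 1} := rfl
  rw [this, sum_pair zero_ne_one, ZMod.card]
  push_cast
  ring

/-- The increment of the mean of the weights under merging. -/
theorem expect_mergeWeight_eq (e : (ZMod 2 × W) ≃ₗ[ZMod 2] V) (w : V → U → ℝ) (c : U) :
    (𝔼 y, 𝔼 s, mergeWeight e w c y s) - 1 = 2 * ((𝔼 v, 𝔼 s, w v s) - 1) +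
      𝔼 y, 𝔼 s, (w (e (0, y)) s - 1) * (w (e (1, y)) (s + c) - 1) := by
  have hshift : ∀ y, 𝔼 s, w (e (1, y)) (s + c) = 𝔼 s, w (e (1, y)) s := fun y =>
    Fintype.expect_equiv (Equiv.addRight c) _ _ fun _ => rfl
  have hexp : ∀ y s, mergeWeight e w c y s =
      (w (e (0, y)) s - 1) * (w (e (1, y)) (s + c) - 1) +
        w (e (0, y)) s + w (e (1, y)) (s + c) - 1 := fun y s => by
    unfold mergeWeight
    ring
  simp only [hexp, expect_add_distrib, expect_sub_distrib, hshift, Fintype.expect_const]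
  rw [mul_sub, expect_split e]
  ring

/-- The increment, averaged over the shift, is the autocorrelation of the marginal. -/
theorem expect_increment_eq (e : (ZMod 2 × W) ≃ₗ[ZMod 2] V) (w : V → U → ℝ) :
    𝔼 c, 𝔼 y, 𝔼 s, (w (e (0, y)) s - 1) * (w (e (1, y)) (s + c) - 1) =
      𝔼 v, (𝔼 s, (w v s - 1)) * 𝔼 s, (w (v + e (1, 0)) s - 1) := by
  have h₁ : ∀ y, 𝔼 c, 𝔼 s, (w (e (0, y)) s - 1) * (w (e (1, y)) (s + c) - 1) =
      (𝔼 s, (w (e (0, y)) s - 1)) * 𝔼 s, (w (e (1, y)) s - 1) := fun y => by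
    rw [expect_comm, expect_mul]
    refine expect_congr rfl fun s _ => ?_
    rw [← mul_expect]
    congr 1
    exact Fintype.expect_equiv (Equiv.addLeft s) _ _ fun _ => rfl
  have h₂ := expect_split e
    fun v => (𝔼 s, (w v s - 1)) * 𝔼 s, (w (v + e (1, 0)) s - 1)
  have h₃ : (1 : ZMod 2) + 1 = 0 := rfl
  simp only [← map_add, Prod.mk_add_mk, add_zero, zero_add, h₃] at h₂
  rw [expect_comm]
  simp only [h₁]
  have h₄ : 𝔼 y, (𝔼 s, (w (e (1, y)) s - 1)) * 𝔼 s, (w (e (0, y)) s - 1) =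
      𝔼 y, (𝔼 s, (w (e (0, y)) s - 1)) * 𝔼 s, (w (e (1, y)) s - 1) :=
    expect_congr rfl fun y _ => mul_comm _ _
  linarith

variable [Module (ZMod 2) U]

/-- A linear map on `𝔽₂ × W` is a vector together with a linear map on `W`. -/
def homSplit (e : (ZMod 2 × W) ≃ₗ[ZMod 2] V) :
    (U × (W →ₗ[ZMod 2] U)) ≃ (V →ₗ[ZMod 2] U) where
  toFun p := ((LinearMap.toSpanSingleton (ZMod 2) U p.1).coprod p.2).comp e.symm.toLinearMap
  invFun h := (h (e (1, 0)), (h.comp e.toLinearMap).comp (LinearMap.inr (ZMod 2) (ZMod 2) W))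
  left_inv p := by
    ext <;> simp
  right_inv h := by
    ext v
    obtain ⟨⟨b, y⟩, rfl⟩ := e.surjective v
    simp only [LinearMap.coe_comp, LinearEquiv.coe_coe, Function.comp_apply,
      LinearEquiv.symm_apply_apply, LinearMap.coprod_apply, LinearMap.toSpanSingleton_apply,
      LinearMap.inr_apply]
    rw [← map_smul, ← map_smul, ← map_add, ← map_add]
    simp

theorem fiberMean_homSplit (e : (ZMod 2 × W) ≃ₗ[ZMod 2] V) (w : V → U → ℝ) (c : U)
    (h : W →ₗ[ZMod 2] U) :
    fiberMean w (homSplit e (c, h)) = fiberMean (mergeWeight e w c) h := by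
  unfold fiberMean mergeWeight
  refine expect_congr rfl fun s _ => ?_
  rw [← e.toEquiv.prod_comp, Fintype.prod_prod_type, prod_mul_distrib]
  have : (univ : Finset (ZMod 2)) = {0, 1} := rfl
  rw [this, prod_pair zero_ne_one]
  simp [homSplit, add_assoc, add_comm c]

end Split

/-! ### Induction on the dimension -/

open Classical in
/-- Tail bound for the mean of the merged weights under a uniformly random linear map. -/
theorem expect_fiberMean_tail_le {U : Type} [AddCommGroup U] [Module (ZMod 2) U] [Fintype U]
    (d : ℕ) : ∀ (V : Type) [AddCommGroup V] [Module (ZMod 2) V] [Fintype V]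
      [Fintype (V →ₗ[ZMod 2] U)], Module.finrank (ZMod 2) V = d →
      ∀ (w : V → U → ℝ), (∀ v s, 1 ≤ w v s) → ∀ y : ℝ, 1 < y →
        (𝔼 h : V →ₗ[ZMod 2] U, if y ^ 2 ^ d ≤ fiberMean w h then (1 : ℝ) else 0) ≤
          (2 / (y - 1) * ((𝔼 v, 𝔼 s, w v s) - 1)) ^ 2 := by
  induction d with
  | zero =>
    intro V _ _ _ _ hd w hw y hy
    have : Subsingleton V := Module.finrank_zero_iff.mp hd
    have hy₀ : 0 < y - 1 := by linarith
    refine (expect_le_expect fun h _ => ?_).trans_eq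
      (Fintype.expect_const (ι := V →ₗ[ZMod 2] U) _)
    split_ifs with hh
    · have hF : fiberMean w h = 𝔼 v, 𝔼 s, w v s := by
        have : Unique V := ⟨⟨0⟩, fun _ => Subsingleton.elim _ _⟩
        have h0 : h default = 0 := by
          rw [Subsingleton.elim (default : V) 0, map_zero]
        simp [fiberMean, Fintype.expect_eq_sum_div_card, h0]
      rw [hF, pow_zero, pow_one] at hh
      refine one_le_pow₀ ?_
      rw [div_mul_eq_mul_div, le_div_iff₀ hy₀]
      linarith
    · positivity
  | succ d ih =>
    intro V _ _ _ _ hd w hw y hy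
    have : Nontrivial V := Module.nontrivial_of_finrank_pos (R := ZMod 2) (by omega)
    obtain ⟨x, hx, hcorr⟩ := exists_ne_zero_expect_mul_shift_le fun v => 𝔼 s, (w v s - 1)
    obtain ⟨W, e, rfl⟩ := exists_linearEquiv_prod hx
    have : Finite (W →ₗ[ZMod 2] U) := Finite.of_injective _ DFunLike.coe_injective
    let _ : Fintype (W →ₗ[ZMod 2] U) := Fintype.ofFinite _
    have hW : Module.finrank (ZMod 2) W = d := by
      have := e.finrank_eq
      rw [Module.finrank_prod, Module.finrank_self] at this
      omega
    set ε : ℝ := (𝔼 v, 𝔼 s, w v s) - 1 with hε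
    have hmarg : 𝔼 v, 𝔼 s, (w v s - 1) = ε := by
      simp only [expect_sub_distrib, Fintype.expect_const, hε]
    have hε₀ : 0 ≤ ε := by
      rw [← hmarg]
      exact expect_nonneg fun v _ => expect_nonneg fun s _ => sub_nonneg.2 (hw v s)
    set N : U → ℝ := fun c => 𝔼 y, 𝔼 s, (w (e (0, y)) s - 1) * (w (e (1, y)) (s + c) - 1) with hN
    have hN₀ : ∀ c, 0 ≤ N c := fun c => expect_nonneg fun v _ => expect_nonneg fun s _ =>
      mul_nonneg (sub_nonneg.2 (hw _ _)) (sub_nonneg.2 (hw _ _))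
    have hNmean : 𝔼 c, N c ≤ ε ^ 2 := by
      rw [expect_increment_eq e w, ← hmarg]
      exact hcorr
    set k : ℝ := 2 / (y ^ 2 - 1) with hk
    have hy₂ : 1 < y ^ 2 := by nlinarith
    have hk₀ : 0 ≤ k := div_nonneg zero_le_two (by linarith)
    have hstep : ∀ c, (𝔼 h : W →ₗ[ZMod 2] U,
        if y ^ 2 ^ (d + 1) ≤ fiberMean w (homSplit e (c, h)) then (1 : ℝ) else 0) ≤
          (k * (2 * ε)) ^ 2 + 2 * k * N c := fun c => by
      -- Since `y ^ 2 ^ (d + 1) = (y ^ 2) ^ 2 ^ d`, the hypothesis applies with base `y ^ 2`.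
      have h₁ := ih W hW (mergeWeight e w c)
        (fun v s => one_le_mul_of_one_le_of_one_le (hw _ _) (hw _ _)) (y ^ 2) hy₂
      rw [expect_mergeWeight_eq, ← pow_mul, ← pow_succ'] at h₁
      simp only [fiberMean_homSplit]
      have h₂ := min_one_sq_le hk₀ (mul_nonneg zero_le_two hε₀)
        (le_add_of_nonneg_right (hN₀ c) : 2 * ε ≤ 2 * ε + N c)
      rw [add_sub_cancel_left] at h₂
      refine (le_min ?_ h₁).trans h₂
      refine (expect_le_expect fun h _ => ?_).trans_eq
        (Fintype.expect_const (ι := W →ₗ[ZMod 2] U) _)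
      split_ifs <;> norm_num
    rw [← Fintype.expect_equiv (homSplit e) (fun p => if y ^ 2 ^ (d + 1) ≤
      fiberMean w (homSplit e p) then (1 : ℝ) else 0) _ fun _ => rfl, ← univ_product_univ,
      expect_product]
    calc _ ≤ 𝔼 c, ((k * (2 * ε)) ^ 2 + 2 * k * N c) := expect_le_expect fun c _ => hstep c
      _ = (k * (2 * ε)) ^ 2 + 2 * k * 𝔼 c, N c := by
        rw [expect_add_distrib, Fintype.expect_const, ← mul_expect]
      _ ≤ (k * (2 * ε)) ^ 2 + 2 * k * ε ^ 2 := by gcongr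
      _ = (4 * k ^ 2 + 2 * k) * ε ^ 2 := by ring
      _ ≤ (2 / (y - 1)) ^ 2 * ε ^ 2 :=
        mul_le_mul_of_nonneg_right (two_div_sq_recursion hy) (sq_nonneg ε)
      _ = _ := by ring

/-! ### Application to the maximum load -/

open Classical in
/-- The weight `b` on the points of `S × {0}`, and `1` elsewhere. -/
def pointWeight {u l : ℕ} (S : Finset (F2Vec u)) (b : ℝ) (x : F2Vec u) (s : F2Vec l) : ℝ :=
  if x ∈ S ∧ s = 0 then b else 1

theorem prod_pointWeight {u l : ℕ} (S : Finset (F2Vec u)) (b : ℝ) (h : F2LinMap u l)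
    (s : F2Vec l) : ∏ x, pointWeight S b x (-s + h x) = b ^ load S h s := by
  classical
  unfold pointWeight load
  rw [prod_ite, prod_const, prod_const_one, mul_one]
  congr 2
  ext x
  simp only [mem_filter, mem_univ, true_and, neg_add_eq_zero, and_congr_right_iff]
  exact fun _ => eq_comm

theorem expect_pointWeight {u l : ℕ} (S : Finset (F2Vec u)) (b : ℝ) :
    (𝔼 x, 𝔼 s : F2Vec l, pointWeight S b x s) - 1 = S.card * (b - 1) / (2 ^ u * 2 ^ l) := by
  classical
  have h₁ : ∀ (x : F2Vec u) (s : F2Vec l), pointWeight S b x s =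
      (if s = 0 then if x ∈ S then b - 1 else 0 else 0) + 1 := fun x s => by
    unfold pointWeight
    by_cases hx : x ∈ S <;> by_cases hs : s = 0 <;> simp [hx, hs]
  simp only [h₁, expect_add_distrib, Fintype.expect_const, add_sub_cancel_right]
  simp only [Fintype.expect_eq_sum_div_card, sum_ite_eq', mem_univ, if_true, ← sum_div,
    sum_ite_mem, univ_inter, sum_const, nsmul_eq_mul, Fintype.card_fun, ZMod.card, Fintype.card_fin]
  push_cast
  rw [div_div, mul_comm ((2 : ℝ) ^ l)]

theorem exp_le_fiberMean_of_le_maxLoad {u l : ℕ} (S : Finset (F2Vec u)) (h : F2LinMap u l)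
    {T : ℝ} (hT : 0 < T) (hM : T ≤ maxLoad S h) :
    Real.exp T ≤ fiberMean (pointWeight S (Real.exp 1 * ((2 : ℝ) ^ l) ^ (1 / T))) h := by
  set n : ℝ := (2 : ℝ) ^ l with hn
  have hn₁ : 1 ≤ n := one_le_pow₀ one_le_two
  set b : ℝ := Real.exp 1 * n ^ (1 / T) with hb
  have hb₁ : 1 ≤ b := one_le_mul_of_one_le_of_one_le (Real.one_le_exp zero_le_one)
    (Real.one_le_rpow hn₁ (by positivity))
  obtain ⟨y, -, hy⟩ := exists_mem_eq_sup' univ_nonempty fun y : F2Vec l => load S h y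
  have hload : T ≤ (load S h y : ℝ) := by
    rw [← hy]
    exact hM
  -- The factor `n ^ (1 / T)` in `b` pays for averaging over `n` bins.
  have hbT : Real.exp T * n ≤ b ^ load S h y := by
    calc Real.exp T * n = b ^ T := by
          rw [hb, Real.mul_rpow (Real.exp_pos 1).le (by positivity), Real.exp_one_rpow,
            ← Real.rpow_mul (by positivity), one_div_mul_cancel hT.ne', Real.rpow_one]
      _ ≤ b ^ (load S h y : ℝ) := Real.rpow_le_rpow_of_exponent_le hb₁ hload
      _ = _ := Real.rpow_natCast _ _
  have hsum : fiberMean (pointWeight S b) h = (∑ s, b ^ load S h s) / n := by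
    unfold fiberMean
    rw [Fintype.expect_eq_sum_div_card, ← Equiv.sum_comp (Equiv.neg (F2Vec l))]
    simp only [Equiv.neg_apply, prod_pointWeight]
    simp [hn]
  rw [hsum, le_div_iff₀ (by positivity)]
  exact hbT.trans (single_le_sum (f := fun s => b ^ load S h s)
    (fun s _ => pow_nonneg (zero_le_one.trans hb₁) _) (mem_univ y))

open Classical in
theorem prLinMap_eq_expect (u l : ℕ) (E : Set (F2LinMap u l)) :
    prLinMap u l E = 𝔼 h : F2LinMap u l, if h ∈ E then (1 : ℝ) else 0 := by
  rw [prLinMap_eq, Fintype.expect_eq_sum_div_card, sum_boole, Nat.card_eq_fintype_card,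
    Nat.card_eq_fintype_card, Fintype.card_subtype]

/-- The tail bound for the maximum load, without a lower bound on `T`. -/
theorem prLinMap_maxLoad_ge_le {u l : ℕ} (S : Finset (F2Vec u)) {T : ℝ} (hT : 0 < T) :
    prLinMap u l {h : F2LinMap u l | (maxLoad S h : ℝ) ≥ T} ≤
      (2 * Real.exp 1 * ((S.card : ℝ) / 2 ^ l * ((2 : ℝ) ^ l) ^ (1 / T) / T)) ^ 2 := by
  classical
  set n : ℝ := (2 : ℝ) ^ l with hn
  have hn₀ : 0 < n := by positivity
  have hn₁ : 1 ≤ n := one_le_pow₀ one_le_two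
  set b : ℝ := Real.exp 1 * n ^ (1 / T) with hb
  have hb₁ : 1 ≤ b := one_le_mul_of_one_le_of_one_le (Real.one_le_exp zero_le_one)
    (Real.one_le_rpow hn₁ (by positivity))
  -- This base gives `y ^ 2 ^ u = e ^ T`, and `y - 1 ≥ T / 2 ^ u` cancels the `2 ^ u` in the mean
  -- excess weight.
  set y : ℝ := Real.exp (T / 2 ^ u) with hy
  have hy₁ : T / 2 ^ u ≤ y - 1 := by linarith [Real.add_one_le_exp (T / 2 ^ u)]
  have hT₀ : 0 < T / 2 ^ u := by positivity
  have hpow : y ^ 2 ^ u = Real.exp T := by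
    rw [hy, ← Real.exp_nat_mul]
    push_cast
    rw [mul_div_cancel₀ _ (by positivity)]
  have hmain := expect_fiberMean_tail_le (U := F2Vec l) u (F2Vec u) (by simp)
    (pointWeight S b) (fun x s => by unfold pointWeight; split_ifs <;> simp [hb₁]) y (by linarith)
  rw [prLinMap_eq_expect]
  refine (expect_le_expect fun h _ => ?_).trans (hmain.trans ?_)
  · split_ifs with h₁ h₂ h₂
    · exact le_rfl
    · exact absurd (hpow.le.trans (exp_le_fiberMean_of_le_maxLoad S h hT h₁)) h₂
    · exact zero_le_one
    · exact le_rfl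
  · rw [expect_pointWeight, ← hn]
    have h₀ : 0 ≤ b - 1 := by linarith
    refine pow_le_pow_left₀ (mul_nonneg (div_nonneg zero_le_two (by linarith)) (by positivity)) ?_ 2
    calc 2 / (y - 1) * (S.card * (b - 1) / (2 ^ u * n))
        ≤ 2 / (T / 2 ^ u) * (S.card * b / (2 ^ u * n)) := by
          gcongr
          linarith
      _ = _ := by
          rw [hb]
          field_simp

end

theorem theoremC2 :
    ∃ C D : ℝ, 0 < C ∧ 0 < D ∧
      ∀ (u l m : ℕ) (n lam : ℝ) (S : Finset (F2Vec u)),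
        n = (2 : ℝ) ^ l → S.card = m → lam = (m : ℝ) / n →
        ∀ T : ℝ, 0 < T → T ≥ D * lam * n ^ (1 / T) →
          prLinMap u l {h : F2LinMap u l | (maxLoad S h : ℝ) ≥ T} ≤
            C * (lam * n ^ (1 / T) / T) ^ 2 := by
  refine ⟨(2 * Real.exp 1) ^ 2, 1, by positivity, one_pos, ?_⟩
  rintro u l m n lam S rfl rfl rfl T hT -
  rw [← mul_pow]
  exact prLinMap_maxLoad_ge_le S hT
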